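/- For a smooth function $u$ on an open set $\Omega\subset\mathbb R^n$ let $\theta=\sum_{i=1}^n\arctan\lambda_i$, where $\lambda_1,\dots,\lambda_n$ are the eigenvalues of $D^2u$, and let $g=I+(D^2u)^{T}D^2u$ be the metric induced from $\mathbb R^{2n}$ on the gradient graph $\{(x,Du(x)):x\in\Omega\}$. The function $u$ is Hamiltonian stationary on $\Omega$ if $\Delta_g\theta=0$ on $\Omega$, where $\Delta_g$ is the Laplace–Beltrami operator of $g$, and special Lagrangian on $\Omega$ if $\nabla_g\theta=0$ on $\Omega$. For a constant $C$ consider the ordinary differential equation $$\frac{v''}{1+(v')^2}+(n-1)\frac{v'r-v}{r^2+v^2}-C\,\frac{(1+(v')^2)^{1/2}}{(r^2+v^2)^{(n-1)/2}}=0,\qquad (\ast)_{n,C}$$ which, for $v=u'(r)$ and some constant $C$, is the radial form of the Hamiltonian stationary equation. (i) Let $n=2$ and $a\ge 0$, and let $u=u(r)$ be a smooth radial solution of $\Delta_g\theta=0$ on $\{x\in\mathbb R^2:|x|>a\}$. Then $u$ is special Lagrangian there, and $\theta$ is constant; moreover $v=u'$ solves $(\ast)_{2,C}$ on $(a,\infty)$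 for $C=0$ and for no other $C$. (ii) For every $n>2$ there are a function $v\in C^2([0,\infty))$ with $v(0)=v'(0)=1$ that solves $(\ast)_{n,C}$ with $C=1-n$ on $(0,\infty)$, and a function $u$ on $(0,\infty)$ with $u'=v$, such that for every unbounded domain (nonempty connected open set) $\Omega\subset\mathbb R^n\setminus\{0\}$ the radial function $x\mapsto u(|x|)$ is smooth on $\Omega$ and Hamiltonian stationary on $\Omega$, but not special Lagrangian on $\Omega$. -/

import Mathlib

open scoped Matrix ContDiff

noncomputable section

namespace HamiltonianStationary

/-- The `i`-th Euclidean partial derivative `∂ᵢ f` at `x`. -/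
def pd {n : ℕ} (i : Fin n) (f : EuclideanSpace ℝ (Fin n) → ℝ)
    (x : EuclideanSpace ℝ (Fin n)) : ℝ :=
  fderiv ℝ f x (EuclideanSpace.single i 1)

/-- The Hessian matrix `D²u` at `x`. -/
def hess {n : ℕ} (u : EuclideanSpace ℝ (Fin n) → ℝ) (x : EuclideanSpace ℝ (Fin n)) :
    Matrix (Fin n) (Fin n) ℝ :=
  Matrix.of fun i j => pd i (pd j u) x

/-- The Lagrangian phase `θ = ∑ arctan λᵢ`, where the `λᵢ` are the eigenvalues of `D²u`
counted with multiplicity (the roots of its characteristic polynomial). -/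
def phase {n : ℕ} (u : EuclideanSpace ℝ (Fin n) → ℝ) (x : EuclideanSpace ℝ (Fin n)) : ℝ :=
  ((hess u x).charpoly.roots.map Real.arctan).sum

/-- The metric `g = I + (D²u)ᵀ D²u` that the Euclidean metric of `ℝⁿ × ℝⁿ` induces on the
gradient graph `{(x, Du(x))}`, in the coordinates `x`. -/
def metric {n : ℕ} (u : EuclideanSpace ℝ (Fin n) → ℝ) (x : EuclideanSpace ℝ (Fin n)) :
    Matrix (Fin n) (Fin n) ℝ :=
  1 + (hess u x)ᵀ * hess u x

/-- The gradient `(∇f)ⁱ = ∑ⱼ gⁱʲ ∂ⱼ f` of a function on the gradient graph of `u`. -/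
def grad {n : ℕ} (u f : EuclideanSpace ℝ (Fin n) → ℝ) (x : EuclideanSpace ℝ (Fin n)) :
    Fin n → ℝ :=
  (metric u x)⁻¹ *ᵥ fun j => pd j f x

/-- The Laplace-Beltrami operator `Δ_g f = (√det g)⁻¹ ∑ᵢ ∂ᵢ (√det g ∑ⱼ gⁱʲ ∂ⱼ f)` of the gradient
graph of `u`, in the coordinates `x`. -/
def laplaceBeltrami {n : ℕ} (u f : EuclideanSpace ℝ (Fin n) → ℝ)
    (x : EuclideanSpace ℝ (Fin n)) : ℝ :=
  (Real.sqrt (metric u x).det)⁻¹ *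
    ∑ i, pd i (fun y => Real.sqrt (metric u y).det * grad u f y i) x

/-- `u` is a smooth solution of the Hamiltonian stationary equation `Δ_g θ = 0` on `Ω`. -/
def IsHamiltonianStationaryOn {n : ℕ} (Ω : Set (EuclideanSpace ℝ (Fin n)))
    (u : EuclideanSpace ℝ (Fin n) → ℝ) : Prop :=
  ContDiffOn ℝ ∞ u Ω ∧ ∀ x ∈ Ω, laplaceBeltrami u (phase u) x = 0

/-- `u` is a smooth solution of the special Lagrangian equation `∇θ = 0` on `Ω`. -/
def IsSpecialLagrangianOn {n : ℕ} (Ω : Set (EuclideanSpace ℝ (Fin n)))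
    (u : EuclideanSpace ℝ (Fin n) → ℝ) : Prop :=
  ContDiffOn ℝ ∞ u Ω ∧ ∀ x ∈ Ω, grad u (phase u) x = 0

/-- The radial Hamiltonian stationary equation at the radius `r`, as an ordinary differential
equation for `v = u'` with constant `C`:
`v'' / (1 + v'²) + (n - 1) (v' r - v) / (r² + v²) - C √(1 + v'²) / (r² + v²)^((n - 1) / 2) = 0`. -/
def RadialODE (n : ℕ) (C : ℝ) (v : ℝ → ℝ) (r : ℝ) : Prop :=
  deriv (deriv v) r / (1 + deriv v r ^ 2)
    + ((n : ℝ) - 1) * ((deriv v r * r - v r) / (r ^ 2 + v r ^ 2))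
    - C * (Real.sqrt (1 + deriv v r ^ 2) / Real.sqrt ((r ^ 2 + v r ^ 2) ^ (n - 1))) = 0

end HamiltonianStationary

end

/-! # Radial Hamiltonian stationary functions

For `u(x) = f(|x|)` and `v = f'`, the Hessian, the metric and its inverse are combinations of the
identity and `x xᵀ`, so the Hessian has the eigenvalues `v'` (once) and `v / r` (`n - 1` times),
`θ = arctan v' + (n - 1) arctan (v / r)` is radial, and `√(det g) ∇θ = Φ(|x|) x / |x|ⁿ` with the flux
`Φ = √((r² + v²)ⁿ⁻¹) θ' / √(1 + v'²)`. The divergence of this field is `Φ' / |x|ⁿ⁻¹`. Hence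
`Δ_g θ = 0` means that `Φ` is locally constant (`IsRadialOn.laplaceBeltrami_eq_zero_iff`), the
ordinary differential equation is `Φ = C` (`radialODE_iff`), and `∇θ = 0` means `θ' = 0`
(`IsRadialOn.grad_phase_eq_zero_iff`).

*Dimension two.* Let `ρ = √(r² + v²)`. Then `θ' = C √(1 + v'²) / ρ`, while `(log ρ)'` is at most
`√(1 + v'²) / ρ`. So `C θ - C² log ρ` is nondecreasing on `(a, ∞)`. Since `|θ| ≤ π` and
`log ρ ≥ log r → ∞`, this forces `C = 0` (`flux_eq_zero_of_exterior`), and then `θ' = 0`.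

*Dimension `n > 2`.* Let `φ` be the polar angle of the point `(r, v(r))`, at distance `ρ` from the
origin, and `ψ` the angle from the position vector to the tangent. The equation with `C = 1 - n` has
the first integral `ρⁿ sin ψ + (n - 1) ρ² / 2`, so the initial data determine `sin ψ` as a function
of `ρ` (`sinAngle`), and `dφ/dρ = tan ψ / ρ` gives `φ` by a quadrature (`polarAngle`). A Bernoulli
inequality shows `-1 / ρ < sin ψ < 0` for `ρ ≥ 1` (`neg_inv_lt_sinAngle`). Comparison with the
horizontal line at height `1`, for which `sin ψ = -1 / ρ`, then gives `0 < φ ≤ π / 2`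
(`arcsin_inv_le_polarAngle`). So the tangent direction `φ + ψ` stays in `(-π / 2, π / 2)`, and
`r = ρ cos φ` is a regular parameter covering `[0, ∞)`. Inverting it yields the solution
`v` (`exists_radial_solution`). Its flux is `1 - n ≠ 0`, so `θ'` vanishes nowhere. -/

noncomputable section

namespace HamiltonianStationary

/-! ### Rank-one perturbations of scalar matrices -/

section RankOne

variable {n : ℕ} (a b : ℝ) (x : Fin n → ℝ)

/-- The matrix `a I + b x xᵀ`; the Hessian and the metric of a radial function have this form. -/
def scalarAddRankOne : Matrix (Fin n) (Fin n) ℝ :=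
  a • (1 : Matrix (Fin n) (Fin n) ℝ) + b • Matrix.vecMulVec x x

theorem scalarAddRankOne_apply (i j : Fin n) :
    scalarAddRankOne a b x i j = a * (if i = j then 1 else 0) + b * (x i * x j) := by
  simp [scalarAddRankOne, Matrix.vecMulVec_apply, Matrix.one_apply]

theorem scalarAddRankOne_transpose : (scalarAddRankOne a b x)ᵀ = scalarAddRankOne a b x := by
  ext i j
  simp only [Matrix.transpose_apply, scalarAddRankOne_apply, eq_comm, mul_comm]

theorem scalarAddRankOne_mulVec :
    scalarAddRankOne a b x *ᵥ x = (a + b * (x ⬝ᵥ x)) • x := by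
  rw [scalarAddRankOne, Matrix.add_mulVec, Matrix.smul_mulVec, Matrix.smul_mulVec,
    Matrix.one_mulVec, Matrix.vecMulVec_mulVec]
  ext i
  simp
  ring

theorem one_add_scalarAddRankOne_sq :
    1 + scalarAddRankOne a b x * scalarAddRankOne a b x
      = scalarAddRankOne (1 + a ^ 2) (2 * a * b + b ^ 2 * (x ⬝ᵥ x)) x := by
  have h : Matrix.vecMulVec x x * Matrix.vecMulVec x x
      = (x ⬝ᵥ x) • Matrix.vecMulVec x x := by
    rw [Matrix.vecMulVec_mul_vecMulVec, Matrix.vecMulVec_smul]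
  simp only [scalarAddRankOne, add_mul, mul_add, smul_mul_assoc, mul_smul_comm, mul_one, one_mul, h]
  module

theorem charpoly_scalarAddRankOne (hn : 0 < n) :
    (scalarAddRankOne a b x).charpoly
      = (Polynomial.X - Polynomial.C a) ^ (n - 1)
        * (Polynomial.X - Polynomial.C (a + b * (x ⬝ᵥ x))) := by
  have h : scalarAddRankOne a b x
      = Matrix.vecMulVec (b • x) x - Matrix.scalar (Fin n) (-a) := by
    ext i j
    simp [scalarAddRankOne_apply, Matrix.vecMulVec_apply, Matrix.diagonal_apply]
    split_ifs <;> ring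
  obtain ⟨m, rfl⟩ : ∃ m, n = m + 1 := ⟨n - 1, by omega⟩
  rw [h, Matrix.charpoly_sub_scalar, Matrix.charpoly_vecMulVec]
  simp [Polynomial.smul_eq_C_mul]
  ring

theorem roots_charpoly_scalarAddRankOne (hn : 0 < n) :
    (scalarAddRankOne a b x).charpoly.roots
      = (n - 1) • {a} + {a + b * (x ⬝ᵥ x)} := by
  rw [charpoly_scalarAddRankOne a b x hn, Polynomial.roots_mul, Polynomial.roots_pow,
    Polynomial.roots_X_sub_C, Polynomial.roots_X_sub_C]
  exact mul_ne_zero (pow_ne_zero _ (Polynomial.X_sub_C_ne_zero _)) (Polynomial.X_sub_C_ne_zero _)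

theorem det_scalarAddRankOne (hn : 0 < n) :
    (scalarAddRankOne a b x).det = a ^ (n - 1) * (a + b * (x ⬝ᵥ x)) := by
  rw [Matrix.det_eq_sign_charpoly_coeff, charpoly_scalarAddRankOne a b x hn,
    Polynomial.coeff_zero_eq_eval_zero]
  obtain ⟨m, rfl⟩ : ∃ m, n = m + 1 := ⟨n - 1, by omega⟩
  simp
  rw [neg_pow a m]
  ring_nf
  simp

end RankOne

/-! ### Derivatives of radial functions -/

section Radial

variable {n : ℕ} {x : EuclideanSpace ℝ (Fin n)}

theorem pd_congr {f g : EuclideanSpace ℝ (Fin n) → ℝ} (h : f =ᶠ[nhds x] g) (i : Fin n) :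
    pd i f x = pd i g x := by
  rw [pd, pd, h.fderiv_eq]

theorem hasFDerivAt_norm {E : Type*} [NormedAddCommGroup E] [InnerProductSpace ℝ E] {x : E}
    (hx : x ≠ 0) : HasFDerivAt (fun y : E => ‖y‖) (‖x‖⁻¹ • innerSL ℝ x) x := by
  have h := ((hasStrictFDerivAt_norm_sq x).hasFDerivAt).sqrt (by simpa using hx)
  simp only [Real.sqrt_sq (norm_nonneg _)] at h
  convert h using 1
  ext y
  have : ‖x‖ ≠ 0 := by simpa using hx
  simp
  field_simp

theorem dotProduct_self_eq_norm_sq : (fun i => x i) ⬝ᵥ (fun i => x i) = ‖x‖ ^ 2 := by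
  rw [EuclideanSpace.norm_sq_eq]
  simp [dotProduct, sq]

theorem hasFDerivAt_comp_norm {F : ℝ → ℝ} {F' : ℝ} (hx : x ≠ 0) (hF : HasDerivAt F F' ‖x‖) :
    HasFDerivAt (fun y => F ‖y‖) ((F' * ‖x‖⁻¹) • innerSL ℝ x) x := by
  have h := hF.comp_hasFDerivAt x (hasFDerivAt_norm hx)
  rwa [smul_smul] at h

theorem pd_comp_norm {F : ℝ → ℝ} {F' : ℝ} (hx : x ≠ 0) (hF : HasDerivAt F F' ‖x‖) (i : Fin n) :
    pd i (fun y => F ‖y‖) x = F' / ‖x‖ * x i := by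
  rw [pd, (hasFDerivAt_comp_norm hx hF).fderiv]
  simp [EuclideanSpace.inner_single_right, div_eq_mul_inv]

theorem pd_comp_norm_mul {G : ℝ → ℝ} {G' : ℝ} (hx : x ≠ 0) (hG : HasDerivAt G G' ‖x‖)
    (i j : Fin n) :
    pd i (fun y => G ‖y‖ * y j) x
      = G ‖x‖ * (if i = j then 1 else 0) + G' / ‖x‖ * (x i * x j) := by
  have h := (hasFDerivAt_comp_norm hx hG).mul
    (EuclideanSpace.proj j : EuclideanSpace ℝ (Fin n) →L[ℝ] ℝ).hasFDerivAt
  refine (congrArg (fun L => L (EuclideanSpace.single i 1)) h.fderiv).trans ?_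
  simp [EuclideanSpace.inner_single_right, div_eq_mul_inv, eq_comm]
  ring

/-- The divergence of the radial field `G(|x|) x`. -/
theorem sum_pd_comp_norm_mul {G : ℝ → ℝ} {G' : ℝ} (hx : x ≠ 0) (hG : HasDerivAt G G' ‖x‖) :
    ∑ i, pd i (fun y => G ‖y‖ * y i) x = n * G ‖x‖ + ‖x‖ * G' := by
  simp only [pd_comp_norm_mul hx hG, if_true, Finset.sum_add_distrib, ← Finset.mul_sum]
  have h := dotProduct_self_eq_norm_sq (x := x)
  have h0 : ‖x‖ ≠ 0 := by simpa using hx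
  simp only [dotProduct] at h
  rw [h]
  simp
  field_simp

end Radial

/-! ### The Hamiltonian stationary equation for radial functions -/

/-- The phase of a radial function with radial derivative `v`: its Hessian has the eigenvalue `v'`
in the radial direction and `v / r` in the `n - 1` tangential directions. -/
def radialPhase (n : ℕ) (v : ℝ → ℝ) (r : ℝ) : ℝ :=
  Real.arctan (deriv v r) + ((n : ℝ) - 1) * Real.arctan (v r / r)

/-- The flux of `∇θ` through the sphere of radius `r`, up to the area of the unit sphere. The
radial equation with constant `C` says that this flux equals `C`. -/
def radialFlux (n : ℕ) (v : ℝ → ℝ) (r : ℝ) : ℝ :=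
  Real.sqrt ((r ^ 2 + v r ^ 2) ^ (n - 1)) * deriv (radialPhase n v) r
    / Real.sqrt (1 + deriv v r ^ 2)

theorem hasDerivAt_radialPhase (n : ℕ) {v : ℝ → ℝ} {r : ℝ} (hr : 0 < r)
    (hv : DifferentiableAt ℝ v r) (hv' : DifferentiableAt ℝ (deriv v) r) :
    HasDerivAt (radialPhase n v) (deriv (deriv v) r / (1 + deriv v r ^ 2)
      + ((n : ℝ) - 1) * ((deriv v r * r - v r) / (r ^ 2 + v r ^ 2))) r := by
  have h := hv'.hasDerivAt.arctan.add
    (((hv.hasDerivAt.div (hasDerivAt_id r) hr.ne').arctan).const_mul ((n : ℝ) - 1))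
  refine h.congr_deriv ?_
  have h1 : 0 < r ^ 2 + v r ^ 2 := by positivity
  have h2 : 0 < 1 + (v r / r) ^ 2 := by positivity
  simp only [id, Pi.div_apply]
  field_simp

theorem radialODE_iff (n : ℕ) (C : ℝ) {v : ℝ → ℝ} {r : ℝ} (hr : 0 < r)
    (hv : DifferentiableAt ℝ v r) (hv' : DifferentiableAt ℝ (deriv v) r) :
    RadialODE n C v r ↔ radialFlux n v r = C := by
  have h1 : 0 < Real.sqrt ((r ^ 2 + v r ^ 2) ^ (n - 1)) := by positivity
  have h2 : 0 < Real.sqrt (1 + deriv v r ^ 2) := by positivity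
  rw [RadialODE, radialFlux, (hasDerivAt_radialPhase n hr hv hv').deriv, div_eq_iff h2.ne',
    sub_eq_zero, ← mul_div_assoc C, eq_div_iff h1.ne', mul_comm (Real.sqrt (_ ^ (n - 1)))]

section Smooth

variable {n : ℕ} {I : Set ℝ} {v : ℝ → ℝ}

theorem contDiffOn_deriv (hI : IsOpen I) (hv : ContDiffOn ℝ ∞ v I) :
    ContDiffOn ℝ ∞ (deriv v) I :=
  ((contDiffOn_infty_iff_deriv_of_isOpen hI).1 hv).2

theorem differentiableAt_of_contDiffOn (hI : IsOpen I) (hv : ContDiffOn ℝ ∞ v I) {r : ℝ}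
    (hr : r ∈ I) : DifferentiableAt ℝ v r :=
  (hv.contDiffAt (hI.mem_nhds hr)).differentiableAt (by simp)

theorem contDiffOn_radialPhase (hI : IsOpen I) (h0 : I ⊆ Set.Ioi 0) (hv : ContDiffOn ℝ ∞ v I) :
    ContDiffOn ℝ ∞ (radialPhase n v) I :=
  (contDiffOn_deriv hI hv).arctan.add
    (contDiffOn_const.mul ((hv.div contDiffOn_id fun _ hr => (h0 hr).ne').arctan))

theorem contDiffOn_radialFlux (hI : IsOpen I) (h0 : I ⊆ Set.Ioi 0) (hv : ContDiffOn ℝ ∞ v I) :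
    ContDiffOn ℝ ∞ (radialFlux n v) I := by
  refine ContDiffOn.div (ContDiffOn.mul (ContDiffOn.sqrt (((contDiffOn_id.pow 2).add
    (hv.pow 2)).pow (n - 1)) ?_) (contDiffOn_deriv hI (contDiffOn_radialPhase hI h0 hv)))
    (ContDiffOn.sqrt (contDiffOn_const.add ((contDiffOn_deriv hI hv).pow 2)) ?_) ?_
  · intro r hr
    have : 0 < r := h0 hr
    positivity
  · intro r hr
    positivity
  · intro r hr
    positivity

end Smooth

/-- On the open set `Ω` the function `u` is `f(|x|)`, where `f` is smooth on the open set `I` of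
positive radii. -/
structure IsRadialOn {n : ℕ} (Ω : Set (EuclideanSpace ℝ (Fin n)))
    (u : EuclideanSpace ℝ (Fin n) → ℝ) (I : Set ℝ) (f : ℝ → ℝ) : Prop where
  isOpen : IsOpen Ω
  isOpen_radii : IsOpen I
  radii_pos : I ⊆ Set.Ioi 0
  norm_mem : ∀ x ∈ Ω, ‖x‖ ∈ I
  eq_comp_norm : ∀ x ∈ Ω, u x = f ‖x‖
  contDiffOn : ContDiffOn ℝ ∞ f I

namespace IsRadialOn

variable {n : ℕ} {Ω : Set (EuclideanSpace ℝ (Fin n))} {u : EuclideanSpace ℝ (Fin n) → ℝ}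
  {I : Set ℝ} {f : ℝ → ℝ} {x : EuclideanSpace ℝ (Fin n)}

theorem norm_pos (h : IsRadialOn Ω u I f) (hx : x ∈ Ω) : 0 < ‖x‖ := h.radii_pos (h.norm_mem x hx)

theorem ne_zero (h : IsRadialOn Ω u I f) (hx : x ∈ Ω) : x ≠ 0 := norm_pos_iff.1 (h.norm_pos hx)

theorem dim_pos (h : IsRadialOn Ω u I f) (hx : x ∈ Ω) : 0 < n := by
  rcases Nat.eq_zero_or_pos n with rfl | hn
  · exact absurd (Subsingleton.elim x 0) (h.ne_zero hx)
  · exact hn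

theorem eventuallyEq (h : IsRadialOn Ω u I f) (hx : x ∈ Ω)
    {F G : EuclideanSpace ℝ (Fin n) → ℝ} (hFG : ∀ y ∈ Ω, F y = G y) : F =ᶠ[nhds x] G :=
  Filter.eventuallyEq_of_mem (h.isOpen.mem_nhds hx) hFG

theorem hasDerivAt (h : IsRadialOn Ω u I f) (hx : x ∈ Ω) {F : ℝ → ℝ} (hF : ContDiffOn ℝ ∞ F I) :
    HasDerivAt F (deriv F ‖x‖) ‖x‖ :=
  (differentiableAt_of_contDiffOn h.isOpen_radii hF (h.norm_mem x hx)).hasDerivAt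

theorem contDiffOn_deriv (h : IsRadialOn Ω u I f) : ContDiffOn ℝ ∞ (deriv f) I :=
  HamiltonianStationary.contDiffOn_deriv h.isOpen_radii h.contDiffOn

theorem contDiffOn_phase (h : IsRadialOn Ω u I f) :
    ContDiffOn ℝ ∞ (radialPhase n (deriv f)) I :=
  contDiffOn_radialPhase h.isOpen_radii h.radii_pos h.contDiffOn_deriv

theorem contDiffOn_comp_norm (h : IsRadialOn Ω u I f) : ContDiffOn ℝ ∞ u Ω :=
  (h.contDiffOn.comp (contDiffOn_id.norm ℝ fun _ hx => h.ne_zero hx) h.norm_mem).congr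
    h.eq_comp_norm

theorem pd_eq (h : IsRadialOn Ω u I f) (hx : x ∈ Ω) (j : Fin n) :
    pd j u x = deriv f ‖x‖ / ‖x‖ * x j := by
  rw [pd_congr (h.eventuallyEq hx h.eq_comp_norm), pd_comp_norm (h.ne_zero hx)
    (h.hasDerivAt hx h.contDiffOn)]

theorem hess_eq (h : IsRadialOn Ω u I f) (hx : x ∈ Ω) :
    hess u x = scalarAddRankOne (deriv f ‖x‖ / ‖x‖)
      ((deriv (deriv f) ‖x‖ * ‖x‖ - deriv f ‖x‖) / ‖x‖ ^ 3) (fun i => x i) := by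
  have h0 := (h.norm_pos hx).ne'
  have hG := (h.hasDerivAt hx h.contDiffOn_deriv).div (hasDerivAt_id ‖x‖) h0
  ext i j
  rw [hess, Matrix.of_apply, pd_congr (h.eventuallyEq hx fun y hy => h.pd_eq hy j)]
  refine (pd_comp_norm_mul (h.ne_zero hx) hG i j).trans ?_
  rw [scalarAddRankOne_apply]
  simp only [Pi.div_apply, id]
  field_simp

/-- The radial eigenvalue of the Hessian, in the form in which it arises from `hess_eq`. -/
theorem radial_eigenvalue (h : IsRadialOn Ω u I f) (hx : x ∈ Ω) :
    deriv f ‖x‖ / ‖x‖ + (deriv (deriv f) ‖x‖ * ‖x‖ - deriv f ‖x‖) / ‖x‖ ^ 3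
      * ((fun i => x i) ⬝ᵥ fun i => x i) = deriv (deriv f) ‖x‖ := by
  have h0 := (h.norm_pos hx).ne'
  rw [dotProduct_self_eq_norm_sq]
  field_simp
  ring

theorem phase_eq (h : IsRadialOn Ω u I f) (hx : x ∈ Ω) :
    phase u x = radialPhase n (deriv f) ‖x‖ := by
  have hn := h.dim_pos hx
  rw [phase, h.hess_eq hx, roots_charpoly_scalarAddRankOne _ _ _ hn, h.radial_eigenvalue hx]
  simp [radialPhase, Multiset.map_nsmul, Multiset.sum_nsmul,
    Nat.cast_sub (Nat.one_le_iff_ne_zero.2 hn.ne')]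
  ring

theorem one_add_sq_add_mul (a b s : ℝ) :
    1 + a ^ 2 + (2 * a * b + b ^ 2 * s) * s = 1 + (a + b * s) ^ 2 := by
  ring

theorem metric_det (h : IsRadialOn Ω u I f) (hx : x ∈ Ω) :
    (metric u x).det
      = (1 + (deriv f ‖x‖ / ‖x‖) ^ 2) ^ (n - 1) * (1 + deriv (deriv f) ‖x‖ ^ 2) := by
  rw [metric, h.hess_eq hx, scalarAddRankOne_transpose, one_add_scalarAddRankOne_sq,
    det_scalarAddRankOne _ _ _ (h.dim_pos hx), one_add_sq_add_mul, h.radial_eigenvalue hx]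

theorem metric_mulVec (h : IsRadialOn Ω u I f) (hx : x ∈ Ω) :
    (metric u x) *ᵥ (fun i => x i) = (1 + deriv (deriv f) ‖x‖ ^ 2) • fun i => x i := by
  rw [metric, h.hess_eq hx, scalarAddRankOne_transpose, one_add_scalarAddRankOne_sq,
    scalarAddRankOne_mulVec, one_add_sq_add_mul, h.radial_eigenvalue hx]

theorem grad_phase (h : IsRadialOn Ω u I f) (hx : x ∈ Ω) :
    grad u (phase u) x = (deriv (radialPhase n (deriv f)) ‖x‖
      / (‖x‖ * (1 + deriv (deriv f) ‖x‖ ^ 2))) • fun i => x i := by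
  have h0 := h.norm_pos hx
  have hd : IsUnit (metric u x).det := by
    rw [h.metric_det hx]
    exact (by positivity : (0 : ℝ) < _).ne'.isUnit
  have h1 : (fun j => pd j (phase u) x)
      = (deriv (radialPhase n (deriv f)) ‖x‖ / ‖x‖) • fun i => x i := by
    ext j
    rw [pd_congr (h.eventuallyEq hx fun y hy => h.phase_eq hy), pd_comp_norm (h.ne_zero hx)
      (h.hasDerivAt hx h.contDiffOn_phase)]
    simp
  have h2 : (fun j => pd j (phase u) x) = metric u x *ᵥ ((deriv (radialPhase n (deriv f)) ‖x‖
      / (‖x‖ * (1 + deriv (deriv f) ‖x‖ ^ 2))) • fun i => x i) := by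
    rw [Matrix.mulVec_smul, h.metric_mulVec hx, smul_smul, h1]
    congr 1
    field_simp
  rw [grad, h2, Matrix.mulVec_mulVec, Matrix.nonsing_inv_mul _ hd, Matrix.one_mulVec]

theorem grad_phase_eq_zero_iff (h : IsRadialOn Ω u I f) (hx : x ∈ Ω) :
    grad u (phase u) x = 0 ↔ deriv (radialPhase n (deriv f)) ‖x‖ = 0 := by
  have h0 := h.norm_pos hx
  have hne : (fun i => x i) ≠ 0 := fun hc => h.ne_zero hx (by ext i; exact congrFun hc i)
  have h1 : ‖x‖ * (1 + deriv (deriv f) ‖x‖ ^ 2) ≠ 0 := by positivity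
  rw [h.grad_phase hx, smul_eq_zero, or_iff_left hne, div_eq_zero_iff, or_iff_left h1]

/-- The divergence of this field is `√(det g) Δ_g θ`. -/
theorem sqrt_det_mul_grad_phase (h : IsRadialOn Ω u I f) (hx : x ∈ Ω) (i : Fin n) :
    Real.sqrt (metric u x).det * grad u (phase u) x i
      = radialFlux n (deriv f) ‖x‖ / ‖x‖ ^ n * x i := by
  have h0 := h.norm_pos hx
  obtain ⟨m, rfl⟩ : ∃ m, n = m + 1 := ⟨n - 1, by have := h.dim_pos hx; omega⟩
  have h1 : 1 + (deriv f ‖x‖ / ‖x‖) ^ 2 = (‖x‖ ^ 2 + deriv f ‖x‖ ^ 2) / ‖x‖ ^ 2 := by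
    field_simp
  have h2 : Real.sqrt (1 + deriv (deriv f) ‖x‖ ^ 2) ^ 2 = 1 + deriv (deriv f) ‖x‖ ^ 2 :=
    Real.sq_sqrt (by positivity)
  have h3 : 0 < Real.sqrt (1 + deriv (deriv f) ‖x‖ ^ 2) := by positivity
  rw [h.metric_det hx, h.grad_phase hx, Real.sqrt_mul (by positivity), h1, div_pow,
    Real.sqrt_div (by positivity), ← pow_mul, mul_comm 2, pow_mul,
    Real.sqrt_sq (by positivity), radialFlux]
  simp only [Pi.smul_apply, smul_eq_mul, Nat.add_sub_cancel]
  rw [← h2]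
  simp only [Real.sqrt_sq h3.le]
  field_simp
  ring

/-- For a radial function `Δ_g θ = 0` is the conservation of the flux. -/
theorem laplaceBeltrami_eq_zero_iff (h : IsRadialOn Ω u I f) (hx : x ∈ Ω) :
    laplaceBeltrami u (phase u) x = 0 ↔ deriv (radialFlux n (deriv f)) ‖x‖ = 0 := by
  have h0 := h.norm_pos hx
  have hd : 0 < Real.sqrt (metric u x).det := by
    rw [h.metric_det hx]
    positivity
  have hG := (h.hasDerivAt hx (contDiffOn_radialFlux (n := n) h.isOpen_radii h.radii_pos
    h.contDiffOn_deriv)).div (hasDerivAt_pow n ‖x‖) (pow_ne_zero n h0.ne')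
  have hsum : ∑ i, pd i (fun y => Real.sqrt (metric u y).det * grad u (phase u) y i) x
      = deriv (radialFlux n (deriv f)) ‖x‖ / ‖x‖ ^ (n - 1) := by
    rw [Finset.sum_congr rfl fun i _ =>
      pd_congr (h.eventuallyEq hx fun y hy => h.sqrt_det_mul_grad_phase hy i) i]
    refine (sum_pd_comp_norm_mul (h.ne_zero hx) hG).trans ?_
    obtain ⟨m, rfl⟩ : ∃ m, n = m + 1 := ⟨n - 1, by have := h.dim_pos hx; omega⟩
    simp only [Pi.div_apply, Nat.add_sub_cancel]
    field_simp
    ring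
  have h1 : ‖x‖ ^ (n - 1) ≠ 0 := by positivity
  rw [laplaceBeltrami, hsum, mul_eq_zero, or_iff_right (inv_ne_zero hd.ne'), div_eq_zero_iff,
    or_iff_left h1]

end IsRadialOn

/-! ### Dimension two -/

theorem abs_radialPhase_two_le (v : ℝ → ℝ) (r : ℝ) : |radialPhase 2 v r| ≤ Real.pi := by
  have h1 := Real.arctan_lt_pi_div_two (deriv v r)
  have h2 := Real.neg_pi_div_two_lt_arctan (deriv v r)
  have h3 := Real.arctan_lt_pi_div_two (v r / r)
  have h4 := Real.neg_pi_div_two_lt_arctan (v r / r)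
  rw [radialPhase, abs_le]
  constructor <;> norm_num <;> linarith

/-- Along the curve `(r, v(r))` with arc length `s` and distance `ρ` from the origin, the equation
reads `dθ/ds = C / ρ`, while `|d log ρ/ds| ≤ 1 / ρ`. Hence `C θ - C² log ρ` is monotone, which is
impossible for `C ≠ 0` because `θ` is bounded and `ρ ≥ r` is not. -/
theorem flux_eq_zero_of_exterior {a C : ℝ} (ha : 0 ≤ a) {v : ℝ → ℝ}
    (hv : ContDiffOn ℝ ∞ v (Set.Ioi a)) (hC : ∀ r, a < r → radialFlux 2 v r = C) : C = 0 := by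
  by_contra hne
  have h0 : Set.Ioi a ⊆ Set.Ioi 0 := Set.Ioi_subset_Ioi ha
  set W : ℝ → ℝ := fun r => C * radialPhase 2 v r - C ^ 2 * (Real.log (r ^ 2 + v r ^ 2) / 2)
    with hW
  have hderiv : ∀ r ∈ Set.Ioi a, ∃ W', HasDerivAt W W' r ∧ 0 ≤ W' := by
    intro r hr
    have hr0 : 0 < r := h0 hr
    have hρ : 0 < r ^ 2 + v r ^ 2 := by positivity
    have hvr := (differentiableAt_of_contDiffOn isOpen_Ioi hv hr).hasDerivAt
    have hθ := (differentiableAt_of_contDiffOn isOpen_Ioi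
      (contDiffOn_radialPhase (n := 2) isOpen_Ioi h0 hv) hr).hasDerivAt
    have hL := ((((hasDerivAt_id r).pow 2).add (hvr.pow 2)).log hρ.ne').div_const 2
    refine ⟨_, (hθ.const_mul C).sub (hL.const_mul (C ^ 2)), ?_⟩
    have hflux := hC r hr
    have hA : 0 < Real.sqrt (r ^ 2 + v r ^ 2) := by positivity
    have hB : 0 < Real.sqrt (1 + deriv v r ^ 2) := by positivity
    have hA2 := Real.sq_sqrt hρ.le
    have hB2 := Real.sq_sqrt (by positivity : 0 ≤ 1 + deriv v r ^ 2)
    simp only [radialFlux, Nat.add_one_sub_one, pow_one] at hflux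
    have hθ' : deriv (radialPhase 2 v) r
        = C * Real.sqrt (1 + deriv v r ^ 2) / Real.sqrt (r ^ 2 + v r ^ 2) := by
      rw [← hflux]
      field_simp
    -- the Cauchy-Schwarz inequality for the position and the velocity `(1, v')` of the curve
    have hCS : r + v r * deriv v r
        ≤ Real.sqrt (r ^ 2 + v r ^ 2) * Real.sqrt (1 + deriv v r ^ 2) := by
      rw [← Real.sqrt_mul hρ.le]
      apply Real.le_sqrt_of_sq_le
      nlinarith [sq_nonneg (r * deriv v r - v r)]
    have hle : (r + v r * deriv v r) / (r ^ 2 + v r ^ 2)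
        ≤ Real.sqrt (1 + deriv v r ^ 2) / Real.sqrt (r ^ 2 + v r ^ 2) := by
      rw [div_le_div_iff₀ hρ hA]
      nth_rewrite 2 [← hA2]
      nlinarith
    have hfin : 0 ≤ C ^ 2 * (Real.sqrt (1 + deriv v r ^ 2) / Real.sqrt (r ^ 2 + v r ^ 2)
        - (r + v r * deriv v r) / (r ^ 2 + v r ^ 2)) :=
      mul_nonneg (sq_nonneg C) (sub_nonneg.2 hle)
    refine hfin.trans_eq ?_
    rw [hθ']
    simp
    ring
  have hmono : MonotoneOn W (Set.Ioi a) := by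
    refine monotoneOn_of_deriv_nonneg (convex_Ioi a) ?_ ?_ ?_
    · intro r hr
      obtain ⟨W', h, -⟩ := hderiv r hr
      exact h.continuousAt.continuousWithinAt
    · rw [interior_Ioi]
      intro r hr
      obtain ⟨W', h, -⟩ := hderiv r hr
      exact h.differentiableAt.differentiableWithinAt
    · rw [interior_Ioi]
      intro r hr
      obtain ⟨W', h, h'⟩ := hderiv r hr
      rwa [h.deriv]
  have hC2 : 0 < C ^ 2 := by positivity
  obtain ⟨r, hr1, hr2⟩ := ((Filter.tendsto_atTop.1 Real.tendsto_log_atTop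
    ((|C| * Real.pi - W (a + 1)) / C ^ 2 + 1)).and (Filter.eventually_ge_atTop (a + 1))).exists
  have hr0 : 0 < r := by linarith
  have h1 := hmono (Set.mem_Ioi.2 (by linarith : a < a + 1)) (Set.mem_Ioi.2 (by linarith)) hr2
  have h2 : C * radialPhase 2 v r ≤ |C| * Real.pi := by
    refine (le_abs_self _).trans ?_
    rw [abs_mul]
    exact mul_le_mul_of_nonneg_left (abs_radialPhase_two_le v r) (abs_nonneg C)
  have h3 : Real.log r ≤ Real.log (r ^ 2 + v r ^ 2) / 2 := by
    have := Real.log_le_log (by positivity) (le_add_of_nonneg_right (sq_nonneg (v r)) :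
      r ^ 2 ≤ r ^ 2 + v r ^ 2)
    rw [Real.log_pow] at this
    push_cast at this
    linarith
  have h4 : C ^ 2 * ((|C| * Real.pi - W (a + 1)) / C ^ 2 + 1)
      = |C| * Real.pi - W (a + 1) + C ^ 2 := by
    field_simp
  have h5 := mul_le_mul_of_nonneg_left (hr1.trans h3) hC2.le
  have h6 : W r = C * radialPhase 2 v r - C ^ 2 * (Real.log (r ^ 2 + v r ^ 2) / 2) := rfl
  linarith

theorem special_of_exterior {a : ℝ} (ha : 0 ≤ a) {u : EuclideanSpace ℝ (Fin 2) → ℝ} {f : ℝ → ℝ}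
    (hu : ∀ x : EuclideanSpace ℝ (Fin 2), a < ‖x‖ → u x = f ‖x‖)
    (hs : IsHamiltonianStationaryOn {x | a < ‖x‖} u) :
    IsSpecialLagrangianOn {x | a < ‖x‖} u ∧
      (∃ c : ℝ, ∀ x : EuclideanSpace ℝ (Fin 2), a < ‖x‖ → phase u x = c) ∧
      (∀ C : ℝ, (∀ r : ℝ, a < r → RadialODE 2 C (deriv f) r) ↔ C = 0) := by
  have h0 : Set.Ioi a ⊆ Set.Ioi 0 := Set.Ioi_subset_Ioi ha
  have hnorm : ∀ r : ℝ, a < r → ‖EuclideanSpace.single (0 : Fin 2) r‖ = r := fun r hr => by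
    simpa using (ha.trans hr.le)
  have hf : ContDiffOn ℝ ∞ f (Set.Ioi a) := by
    have hsingle : ContDiff ℝ ∞ fun r : ℝ => EuclideanSpace.single (0 : Fin 2) r := by
      have : (fun r : ℝ => EuclideanSpace.single (0 : Fin 2) r)
          = fun r : ℝ => r • EuclideanSpace.single (0 : Fin 2) (1 : ℝ) := by
        ext r i
        simp
      rw [this]
      fun_prop
    refine (hs.1.comp (s := Set.Ioi a) hsingle.contDiffOn fun r hr => ?_).congr fun r hr => ?_
    · simpa [hnorm r hr] using hr
    · have := hu (EuclideanSpace.single 0 r) (by rwa [hnorm r hr])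
      rw [hnorm r hr] at this
      exact this.symm
  have hrad : IsRadialOn {x : EuclideanSpace ℝ (Fin 2) | a < ‖x‖} u (Set.Ioi a) f :=
    ⟨isOpen_lt continuous_const continuous_norm, isOpen_Ioi, h0, fun x hx => hx, hu, hf⟩
  have hv := hrad.contDiffOn_deriv
  have hode : ∀ C r, a < r → (RadialODE 2 C (deriv f) r ↔ radialFlux 2 (deriv f) r = C) :=
    fun C r hr => radialODE_iff 2 C (h0 hr) (differentiableAt_of_contDiffOn isOpen_Ioi hv hr)
      (differentiableAt_of_contDiffOn isOpen_Ioi (contDiffOn_deriv isOpen_Ioi hv) hr)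
  have hflux' : ∀ r ∈ Set.Ioi a, deriv (radialFlux 2 (deriv f)) r = 0 := by
    intro r hr
    have hx : EuclideanSpace.single (0 : Fin 2) r ∈ {x : EuclideanSpace ℝ (Fin 2) | a < ‖x‖} := by
      simpa [hnorm r hr] using hr
    have := (hrad.laplaceBeltrami_eq_zero_iff hx).1 (hs.2 _ hx)
    rwa [hnorm r hr] at this
  obtain ⟨C₀, hC₀⟩ := isOpen_Ioi.exists_is_const_of_deriv_eq_zero
    isPreconnected_Ioi
    (fun r hr => (differentiableAt_of_contDiffOn isOpen_Ioi
      (contDiffOn_radialFlux (n := 2) isOpen_Ioi h0 hv) hr).differentiableWithinAt) hflux'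
  obtain rfl : C₀ = 0 := flux_eq_zero_of_exterior ha hv hC₀
  have hθ' : ∀ r ∈ Set.Ioi a, deriv (radialPhase 2 (deriv f)) r = 0 := by
    intro r hr
    have hr0 : 0 < r := h0 hr
    have h1 : Real.sqrt ((r ^ 2 + deriv f r ^ 2) ^ (2 - 1)) ≠ 0 := by positivity
    have h2 : Real.sqrt (1 + deriv (deriv f) r ^ 2) ≠ 0 := by positivity
    have h3 := hC₀ r hr
    rw [radialFlux, div_eq_zero_iff, or_iff_left h2, mul_eq_zero, or_iff_right h1] at h3
    exact h3
  refine ⟨⟨hs.1, fun x hx => (hrad.grad_phase_eq_zero_iff hx).2 (hθ' _ hx)⟩, ?_, ?_⟩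
  · obtain ⟨c, hc⟩ := isOpen_Ioi.exists_is_const_of_deriv_eq_zero
      isPreconnected_Ioi
      (fun r hr => (differentiableAt_of_contDiffOn isOpen_Ioi
        hrad.contDiffOn_phase hr).differentiableWithinAt) hθ'
    exact ⟨c, fun x hx => (hrad.phase_eq hx).trans (hc _ hx)⟩
  · refine fun C => ⟨fun h => ?_, fun h r hr => (hode C r hr).2 (h ▸ hC₀ r hr)⟩
    have hr : a < a + 1 := by linarith
    exact ((hode C _ hr).1 (h _ hr)).symm.trans (hC₀ _ hr)

/-! ### Smooth primitives and inverse functions on the line -/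

theorem hasDerivAt_integral_of_contDiffOn {J : Set ℝ} (hJ : IsOpen J) (hc : J.OrdConnected)
    {g : ℝ → ℝ} (hg : ContDiffOn ℝ ∞ g J) {a t : ℝ} (ha : a ∈ J) (ht : t ∈ J) :
    HasDerivAt (fun t => ∫ s in a..t, g s) (g t) t :=
  intervalIntegral.integral_hasDerivAt_right
    ((hg.continuousOn.mono (hc.uIcc_subset ha ht)).intervalIntegrable)
    (hg.continuousOn.stronglyMeasurableAtFilter hJ t ht)
    (hg.continuousOn.continuousAt (hJ.mem_nhds ht))

theorem contDiffOn_of_hasDerivAt {J : Set ℝ} (hJ : IsOpen J) {F g : ℝ → ℝ}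
    (hF : ∀ t ∈ J, HasDerivAt F (g t) t) (hg : ContDiffOn ℝ ∞ g J) : ContDiffOn ℝ ∞ F J :=
  (contDiffOn_infty_iff_deriv_of_isOpen hJ).2
    ⟨fun t ht => (hF t ht).differentiableAt.differentiableWithinAt,
      hg.congr fun t ht => (hF t ht).deriv⟩

theorem invFunOn_of_hasDerivAt {J : Set ℝ} (hJ : IsOpen J) {R : ℝ → ℝ} {R' t : ℝ}
    (hinj : Set.InjOn R J) (hR : ContDiffOn ℝ ∞ R J) (ht : t ∈ J) (hR' : HasDerivAt R R' t)
    (hne : R' ≠ 0) :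
    ContDiffAt ℝ ∞ (Function.invFunOn R J) (R t) ∧
      HasDerivAt (Function.invFunOn R J) R'⁻¹ (R t) ∧
      ∀ᶠ y in nhds (R t), Function.invFunOn R J y ∈ J ∧ R (Function.invFunOn R J y) = y := by
  have hRt : ContDiffAt ℝ ∞ R t := hR.contDiffAt (hJ.mem_nhds ht)
  have hs : HasStrictDerivAt R R' t := by
    have := hRt.hasStrictDerivAt (by simp)
    rwa [hR'.deriv] at this
  have hmem : ∀ᶠ y in nhds (R t), hs.localInverse R R' t hne y ∈ J := by
    have hc : ContinuousAt (hs.localInverse R R' t hne) (R t) :=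
      (hs.to_localInverse hne).hasDerivAt.continuousAt
    have h1 : hs.localInverse R R' t hne (R t) = t :=
      HasStrictFDerivAt.localInverse_apply_image _
    exact hc.eventually (by rw [h1]; exact hJ.mem_nhds ht)
  have hright : ∀ᶠ y in nhds (R t), R (hs.localInverse R R' t hne y) = y :=
    HasStrictFDerivAt.eventually_right_inverse _
  have hev : ∀ᶠ y in nhds (R t), Function.invFunOn R J y ∈ J ∧ R (Function.invFunOn R J y) = y := by
    filter_upwards [hmem, hright] with y h1 h2
    exact Function.invFunOn_pos ⟨_, h1, h2⟩
  have heq : Function.invFunOn R J =ᶠ[nhds (R t)] hs.localInverse R R' t hne := by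
    filter_upwards [hmem, hright, hev] with y h1 h2 h3
    exact hinj h3.1 h1 (h3.2.trans h2.symm)
  refine ⟨?_, (hs.to_localInverse hne).hasDerivAt.congr_of_eventuallyEq heq, hev⟩
  have := hRt.to_localInverse (f' := ContinuousLinearEquiv.unitsEquivAut ℝ (Units.mk0 R' hne))
    hR'.hasFDerivAt (by simp)
  exact this.congr_of_eventuallyEq heq

/-! ### The profile curve in polar coordinates -/

/-- The sine of the angle `ψ` from the position vector to the tangent vector of the curve
`(r, v(r))`, as a function of the distance `ρ` from the origin. For `C = 1 - n` the quantity
`ρⁿ sin ψ + (n - 1) ρ² / 2` is conserved along the curve, and the initial data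
`v(0) = v'(0) = 1` give `ρ = 1`, `ψ = -π / 4`. -/
def sinAngle (n : ℕ) (ρ : ℝ) : ℝ :=
  -(((n : ℝ) - 1) / 2 * (ρ ^ 2 - 1) + Real.sqrt 2 / 2) / ρ ^ n

/-- The derivative `dφ/dρ = tan ψ / ρ` of the polar angle along the curve. -/
def polarAngleDeriv (n : ℕ) (ρ : ℝ) : ℝ :=
  sinAngle n ρ / (ρ * Real.sqrt (1 - sinAngle n ρ ^ 2))

/-- The polar angle `φ` of the curve at distance `ρ` from the origin; the curve starts on the
vertical axis at `ρ = 1`. -/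
def polarAngle (n : ℕ) (ρ : ℝ) : ℝ :=
  Real.pi / 2 + ∫ t in (1 : ℝ)..ρ, polarAngleDeriv n t

/-- The angle `α = φ + ψ` from the horizontal axis to the tangent of the curve. -/
def tangentAngle (n : ℕ) (ρ : ℝ) : ℝ :=
  polarAngle n ρ + Real.arcsin (sinAngle n ρ)

theorem hasDerivAt_sinAngle {n : ℕ} (hn : 0 < n) {ρ : ℝ} (hρ : 0 < ρ) :
    HasDerivAt (sinAngle n) (-(n * sinAngle n ρ / ρ) - ((n : ℝ) - 1) / ρ ^ (n - 1)) ρ := by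
  have h := ((((hasDerivAt_pow 2 ρ).sub_const 1).const_mul (((n : ℝ) - 1) / 2)).add_const
    (Real.sqrt 2 / 2)).neg.div (hasDerivAt_pow n ρ) (pow_ne_zero n hρ.ne')
  refine h.congr_deriv ?_
  obtain ⟨m, rfl⟩ : ∃ m, n = m + 1 := ⟨n - 1, by omega⟩
  simp only [sinAngle, Nat.add_sub_cancel, Pi.neg_apply]
  push_cast
  field_simp
  ring

theorem contDiffOn_sinAngle (n : ℕ) : ContDiffOn ℝ ∞ (sinAngle n) (Set.Ioi 0) := by
  refine ContDiffOn.div (by fun_prop) (by fun_prop) fun ρ hρ => ?_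
  exact pow_ne_zero n (ne_of_gt hρ)

theorem one_add_half_mul_le_pow {m : ℕ} (hm : 2 ≤ m) {t : ℝ} (ht : 1 ≤ t) :
    1 + (m : ℝ) / 2 * (t ^ 2 - 1) ≤ t ^ m := by
  induction m, hm using Nat.le_induction with
  | base =>
    norm_num
  | succ m hm ih =>
    have h1 : (2 : ℝ) ≤ m := by exact_mod_cast hm
    have h2 := mul_le_mul_of_nonneg_right ih (by linarith : 0 ≤ t)
    rw [pow_succ]
    refine le_trans ?_ h2
    have h3 : 0 ≤ (t - 1) ^ 2 * ((m : ℝ) * (t + 1) - 1) :=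
      mul_nonneg (sq_nonneg _) (by nlinarith)
    push_cast
    nlinarith

theorem sinAngle_neg {n : ℕ} (hn : 0 < n) {ρ : ℝ} (hρ : 1 ≤ ρ) : sinAngle n ρ < 0 := by
  have h1 : (1 : ℝ) ≤ n := by exact_mod_cast hn
  have h2 : 0 ≤ ((n : ℝ) - 1) / 2 * (ρ ^ 2 - 1) :=
    mul_nonneg (by linarith) (by nlinarith)
  rw [sinAngle, neg_div]
  have : 0 < Real.sqrt 2 := by positivity
  have : 0 < (((n : ℝ) - 1) / 2 * (ρ ^ 2 - 1) + Real.sqrt 2 / 2) / ρ ^ n := by positivity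
  linarith

/-- The tangent lines of the curve pass the origin at distance less than `1`. -/
theorem neg_inv_lt_sinAngle {n : ℕ} (hn : 2 < n) {ρ : ℝ} (hρ : 1 ≤ ρ) : -ρ⁻¹ < sinAngle n ρ := by
  obtain ⟨m, rfl⟩ : ∃ m, n = m + 1 := ⟨n - 1, by omega⟩
  have h0 : 0 < ρ := by linarith
  have h1 := one_add_half_mul_le_pow (by omega : 2 ≤ m) hρ
  have h2 : Real.sqrt 2 < 2 := by
    rw [Real.sqrt_lt' (by norm_num)]
    norm_num
  rw [sinAngle, neg_div, neg_lt_neg_iff, div_lt_iff₀ (by positivity), pow_succ' ρ m, ← mul_assoc,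
    inv_mul_cancel₀ h0.ne', one_mul]
  push_cast
  linarith

theorem sinAngle_one (n : ℕ) : sinAngle n 1 = -(Real.sqrt 2 / 2) := by
  simp [sinAngle]

/-- For `ρ > δ` the angle `ψ` lies in `(-π / 2, 0)`, so that `ρ` is a regular parameter of the
curve. The range is larger than the needed `ρ ≥ 1` so that it is a neighbourhood of `1`. -/
structure IsRegularBeyond (n : ℕ) (δ : ℝ) : Prop where
  nonneg : 0 ≤ δ
  lt_one : δ < 1
  neg_one_lt : ∀ ρ, δ < ρ → -1 < sinAngle n ρ
  lt_zero : ∀ ρ, δ < ρ → sinAngle n ρ < 0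

theorem exists_isRegularBeyond {n : ℕ} (hn : 2 < n) : ∃ δ, IsRegularBeyond n δ := by
  have hc : ContinuousAt (sinAngle n) 1 :=
    (hasDerivAt_sinAngle (by omega) one_pos).continuousAt
  have h1 : ∀ᶠ ρ in nhds (1 : ℝ), -1 < sinAngle n ρ ∧ sinAngle n ρ < 0 :=
    (hc.eventually (lt_mem_nhds (by simpa using neg_inv_lt_sinAngle hn le_rfl))).and
      (hc.eventually (gt_mem_nhds (sinAngle_neg (by omega) le_rfl)))
  obtain ⟨ε, hε, h⟩ := Metric.eventually_nhds_iff.1 h1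
  have key : ∀ ρ, max 0 (1 - ε) < ρ → -1 < sinAngle n ρ ∧ sinAngle n ρ < 0 := by
    intro ρ hρ
    rcases lt_or_ge ρ 1 with h2 | h2
    · refine h ?_
      rw [Real.dist_eq, abs_lt]
      have := (max_lt_iff.1 hρ).2
      constructor <;> linarith
    · refine ⟨lt_of_le_of_lt ?_ (neg_inv_lt_sinAngle hn h2), sinAngle_neg (by omega) h2⟩
      exact neg_le_neg (inv_le_one_of_one_le₀ h2)
  exact ⟨max 0 (1 - ε), le_max_left _ _, max_lt one_pos (by linarith), fun ρ hρ => (key ρ hρ).1,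
    fun ρ hρ => (key ρ hρ).2⟩

namespace IsRegularBeyond

variable {n : ℕ} {δ ρ : ℝ}

theorem pos (h : IsRegularBeyond n δ) (hρ : δ < ρ) : 0 < ρ := h.nonneg.trans_lt hρ

theorem one_sub_sq_pos (h : IsRegularBeyond n δ) (hρ : δ < ρ) : 0 < 1 - sinAngle n ρ ^ 2 := by
  have h1 := h.neg_one_lt ρ hρ
  have h2 := h.lt_zero ρ hρ
  nlinarith

theorem contDiffOn_sinAngle (h : IsRegularBeyond n δ) :
    ContDiffOn ℝ ∞ (sinAngle n) (Set.Ioi δ) :=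
  (HamiltonianStationary.contDiffOn_sinAngle n).mono (Set.Ioi_subset_Ioi h.nonneg)

theorem contDiffOn_polarAngleDeriv (h : IsRegularBeyond n δ) :
    ContDiffOn ℝ ∞ (polarAngleDeriv n) (Set.Ioi δ) := by
  refine h.contDiffOn_sinAngle.div (contDiffOn_id.mul ((contDiffOn_const.sub
    (h.contDiffOn_sinAngle.pow 2)).sqrt fun ρ hρ => (h.one_sub_sq_pos hρ).ne')) fun ρ hρ => ?_
  exact mul_ne_zero (h.pos hρ).ne' (Real.sqrt_pos.2 (h.one_sub_sq_pos hρ)).ne'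

theorem hasDerivAt_polarAngle (h : IsRegularBeyond n δ) (hρ : δ < ρ) :
    HasDerivAt (polarAngle n) (polarAngleDeriv n ρ) ρ :=
  (hasDerivAt_integral_of_contDiffOn isOpen_Ioi Set.ordConnected_Ioi
    h.contDiffOn_polarAngleDeriv (Set.mem_Ioi.2 h.lt_one) hρ).const_add _

theorem contDiffOn_polarAngle (h : IsRegularBeyond n δ) :
    ContDiffOn ℝ ∞ (polarAngle n) (Set.Ioi δ) :=
  contDiffOn_of_hasDerivAt isOpen_Ioi (fun _ hρ => h.hasDerivAt_polarAngle hρ)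
    h.contDiffOn_polarAngleDeriv

theorem polarAngleDeriv_neg (h : IsRegularBeyond n δ) (hρ : δ < ρ) : polarAngleDeriv n ρ < 0 :=
  div_neg_of_neg_of_pos (h.lt_zero ρ hρ)
    (mul_pos (h.pos hρ) (Real.sqrt_pos.2 (h.one_sub_sq_pos hρ)))

theorem strictAntiOn_polarAngle (h : IsRegularBeyond n δ) :
    StrictAntiOn (polarAngle n) (Set.Ioi δ) := by
  refine strictAntiOn_of_deriv_neg (convex_Ioi δ) h.contDiffOn_polarAngle.continuousOn ?_
  rw [interior_Ioi]
  intro ρ hρ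
  rw [(h.hasDerivAt_polarAngle hρ).deriv]
  exact h.polarAngleDeriv_neg hρ

theorem hasDerivAt_tangentAngle (h : IsRegularBeyond n δ) (hn : 0 < n) (hρ : δ < ρ) :
    HasDerivAt (tangentAngle n)
      ((-(((n : ℝ) - 1) * sinAngle n ρ / ρ) - ((n : ℝ) - 1) / ρ ^ (n - 1))
        / Real.sqrt (1 - sinAngle n ρ ^ 2)) ρ := by
  have h0 := h.pos hρ
  have h1 := (h.hasDerivAt_polarAngle hρ).add
    ((Real.hasDerivAt_arcsin (h.neg_one_lt ρ hρ).ne' ((h.lt_zero ρ hρ).trans one_pos).ne).comp ρ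
      (hasDerivAt_sinAngle hn h0))
  refine h1.congr_deriv ?_
  have h2 := Real.sqrt_pos.2 (h.one_sub_sq_pos hρ)
  rw [polarAngleDeriv]
  field_simp
  ring

theorem cos_tangentAngle (h : IsRegularBeyond n δ) (hρ : δ < ρ) :
    Real.cos (tangentAngle n ρ) = Real.cos (polarAngle n ρ) * Real.sqrt (1 - sinAngle n ρ ^ 2)
      - Real.sin (polarAngle n ρ) * sinAngle n ρ := by
  rw [tangentAngle, Real.cos_add, Real.cos_arcsin, Real.sin_arcsin (h.neg_one_lt ρ hρ).le
    ((h.lt_zero ρ hρ).trans one_pos).le]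

theorem sin_tangentAngle (h : IsRegularBeyond n δ) (hρ : δ < ρ) :
    Real.sin (tangentAngle n ρ) = Real.sin (polarAngle n ρ) * Real.sqrt (1 - sinAngle n ρ ^ 2)
      + Real.cos (polarAngle n ρ) * sinAngle n ρ := by
  rw [tangentAngle, Real.sin_add, Real.cos_arcsin, Real.sin_arcsin (h.neg_one_lt ρ hρ).le
    ((h.lt_zero ρ hρ).trans one_pos).le]

theorem hasDerivAt_abscissa (h : IsRegularBeyond n δ) (hρ : δ < ρ) :
    HasDerivAt (fun ρ => ρ * Real.cos (polarAngle n ρ))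
      (Real.cos (tangentAngle n ρ) / Real.sqrt (1 - sinAngle n ρ ^ 2)) ρ := by
  refine ((hasDerivAt_id ρ).mul (h.hasDerivAt_polarAngle hρ).cos).congr_deriv ?_
  have h0 := h.pos hρ
  have h2 := Real.sqrt_pos.2 (h.one_sub_sq_pos hρ)
  rw [h.cos_tangentAngle hρ, polarAngleDeriv]
  simp only [id]
  field_simp
  ring

theorem hasDerivAt_ordinate (h : IsRegularBeyond n δ) (hρ : δ < ρ) :
    HasDerivAt (fun ρ => ρ * Real.sin (polarAngle n ρ))
      (Real.sin (tangentAngle n ρ) / Real.sqrt (1 - sinAngle n ρ ^ 2)) ρ := by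
  refine ((hasDerivAt_id ρ).mul (h.hasDerivAt_polarAngle hρ).sin).congr_deriv ?_
  have h0 := h.pos hρ
  have h2 := Real.sqrt_pos.2 (h.one_sub_sq_pos hρ)
  rw [h.sin_tangentAngle hρ, polarAngleDeriv]
  simp only [id]
  field_simp

end IsRegularBeyond

theorem polarAngle_one (n : ℕ) : polarAngle n 1 = Real.pi / 2 := by
  simp [polarAngle]

theorem tangentAngle_one (n : ℕ) : tangentAngle n 1 = Real.pi / 4 := by
  have h : Real.arcsin (Real.sqrt 2 / 2) = Real.pi / 4 := by
    rw [← Real.sin_pi_div_four]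
    exact Real.arcsin_sin (by linarith [Real.pi_pos]) (by linarith [Real.pi_pos])
  rw [tangentAngle, polarAngle_one, sinAngle_one, Real.arcsin_neg, h]
  ring

/-- The curve stays above the horizontal line through its initial point: the right-hand side is the
polar angle of that line, along which `sin ψ = -1 / ρ`. -/
theorem arcsin_inv_le_polarAngle {n : ℕ} (hn : 2 < n) {ρ : ℝ} (hρ : 1 ≤ ρ) :
    Real.arcsin ρ⁻¹ ≤ polarAngle n ρ := by
  obtain ⟨δ, h⟩ := exists_isRegularBeyond hn
  have hδ : ∀ ρ, 1 ≤ ρ → δ < ρ := fun ρ hρ => h.lt_one.trans_le hρ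
  have hderiv : ∀ ρ ∈ Set.Ioi (1 : ℝ), ∃ d, 0 ≤ d ∧
      HasDerivAt (fun ρ => polarAngle n ρ - Real.arcsin ρ⁻¹) d ρ := by
    intro ρ hρ
    have hρ1 : 1 < ρ := hρ
    have h0 : 0 < ρ := by linarith
    have hi0 : 0 < ρ⁻¹ := inv_pos.2 h0
    have hi1 : ρ⁻¹ < 1 := inv_lt_one_of_one_lt₀ hρ1
    refine ⟨_, ?_, (h.hasDerivAt_polarAngle (hδ ρ hρ1.le)).sub
      ((Real.hasDerivAt_arcsin (by linarith) hi1.ne).comp ρ (hasDerivAt_inv h0.ne'))⟩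
    have hS := neg_inv_lt_sinAngle hn hρ1.le
    have hS0 := h.lt_zero ρ (hδ ρ hρ1.le)
    have h1 : 0 < 1 - ρ⁻¹ ^ 2 := by nlinarith
    have h2 : Real.sqrt (1 - ρ⁻¹ ^ 2) ≤ Real.sqrt (1 - sinAngle n ρ ^ 2) :=
      Real.sqrt_le_sqrt (by nlinarith)
    have h3 : -sinAngle n ρ / Real.sqrt (1 - sinAngle n ρ ^ 2) ≤ ρ⁻¹ / Real.sqrt (1 - ρ⁻¹ ^ 2) :=
      div_le_div₀ hi0.le (by linarith) (Real.sqrt_pos.2 h1) h2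
    have h4 := mul_nonneg hi0.le (sub_nonneg.2 h3)
    refine h4.trans_eq ?_
    rw [polarAngleDeriv]
    have h5 := Real.sqrt_pos.2 h1
    have h6 := Real.sqrt_pos.2 (h.one_sub_sq_pos (hδ ρ hρ1.le))
    field_simp
    ring
  have hmono : MonotoneOn (fun ρ => polarAngle n ρ - Real.arcsin ρ⁻¹) (Set.Ici 1) := by
    refine monotoneOn_of_deriv_nonneg (convex_Ici 1) ?_ ?_ ?_
    · refine ContinuousOn.sub (h.contDiffOn_polarAngle.continuousOn.mono fun ρ hρ => hδ ρ hρ) ?_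
      refine Real.continuous_arcsin.comp_continuousOn (continuousOn_inv₀.mono fun ρ hρ => ?_)
      exact (one_pos.trans_le (Set.mem_Ici.1 hρ)).ne'
    · rw [interior_Ici]
      intro ρ hρ
      obtain ⟨d, -, hd⟩ := hderiv ρ hρ
      exact hd.differentiableAt.differentiableWithinAt
    · rw [interior_Ici]
      intro ρ hρ
      obtain ⟨d, hd0, hd⟩ := hderiv ρ hρ
      rwa [hd.deriv]
  have := hmono (Set.mem_Ici.2 le_rfl) (Set.mem_Ici.2 hρ) hρ
  simp only [polarAngle_one, inv_one, Real.arcsin_one, sub_self] at this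
  linarith

theorem polarAngle_pos {n : ℕ} (hn : 2 < n) {ρ : ℝ} (hρ : 1 ≤ ρ) : 0 < polarAngle n ρ :=
  (Real.arcsin_pos.2 (inv_pos.2 (one_pos.trans_le hρ))).trans_le (arcsin_inv_le_polarAngle hn hρ)

theorem polarAngle_le {n : ℕ} (hn : 2 < n) {ρ : ℝ} (hρ : 1 ≤ ρ) :
    polarAngle n ρ ≤ Real.pi / 2 := by
  obtain ⟨δ, h⟩ := exists_isRegularBeyond hn
  rw [← polarAngle_one n]
  exact h.strictAntiOn_polarAngle.antitoneOn (Set.mem_Ioi.2 h.lt_one)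
    (Set.mem_Ioi.2 (h.lt_one.trans_le hρ)) hρ

theorem cos_tangentAngle_pos {n : ℕ} (hn : 2 < n) {ρ : ℝ} (hρ : 1 ≤ ρ) :
    0 < Real.cos (tangentAngle n ρ) := by
  have h1 : Real.arcsin (sinAngle n ρ) < 0 := Real.arcsin_lt_zero.2 (sinAngle_neg (by omega) hρ)
  have h2 := polarAngle_le hn hρ
  have h3 := polarAngle_pos hn hρ
  have h4 := Real.neg_pi_div_two_le_arcsin (sinAngle n ρ)
  refine Real.cos_pos_of_mem_Ioo ⟨?_, ?_⟩ <;> rw [tangentAngle] <;> linarith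

/-- The regular range can be chosen so that the curve is a graph on it. -/
theorem exists_isRegularBeyond_graph {n : ℕ} (hn : 2 < n) :
    ∃ δ, IsRegularBeyond n δ ∧ ∀ ρ, δ < ρ → 0 < Real.cos (tangentAngle n ρ) := by
  obtain ⟨δ, h⟩ := exists_isRegularBeyond hn
  have hc : ContinuousAt (fun ρ => Real.cos (tangentAngle n ρ)) 1 :=
    (h.hasDerivAt_tangentAngle (by omega) h.lt_one).cos.continuousAt
  obtain ⟨ε, hε, h1⟩ := Metric.eventually_nhds_iff.1
    (hc.eventually (lt_mem_nhds (cos_tangentAngle_pos hn le_rfl)))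
  refine ⟨max δ (1 - ε), ⟨h.nonneg.trans (le_max_left _ _), max_lt h.lt_one (by linarith),
    fun ρ hρ => h.neg_one_lt ρ (max_lt_iff.1 hρ).1, fun ρ hρ => h.lt_zero ρ (max_lt_iff.1 hρ).1⟩,
    fun ρ hρ => ?_⟩
  rcases lt_or_ge ρ 1 with h2 | h2
  · refine h1 ?_
    rw [Real.dist_eq, abs_lt]
    have := (max_lt_iff.1 hρ).2
    constructor <;> linarith
  · exact cos_tangentAngle_pos hn h2

/-- The curve projects onto the whole half-line: its polar angle decreases from `π / 2` and stays
positive, so its abscissa is unbounded. -/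
theorem exists_abscissa_eq {n : ℕ} (hn : 2 < n) {r : ℝ} (hr : 0 ≤ r) :
    ∃ ρ, 1 ≤ ρ ∧ ρ * Real.cos (polarAngle n ρ) = r := by
  obtain ⟨δ, h⟩ := exists_isRegularBeyond hn
  have h2 : polarAngle n 2 < Real.pi / 2 := by
    rw [← polarAngle_one n]
    exact h.strictAntiOn_polarAngle (Set.mem_Ioi.2 h.lt_one)
      (Set.mem_Ioi.2 (h.lt_one.trans one_lt_two)) one_lt_two
  have hk : 0 < Real.cos (polarAngle n 2) :=
    Real.cos_pos_of_mem_Ioo ⟨by linarith [polarAngle_pos hn one_le_two, Real.pi_pos], h2⟩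
  set T : ℝ := max 2 (r / Real.cos (polarAngle n 2)) with hT
  have hT2 : 2 ≤ T := le_max_left _ _
  have hT1 : (1 : ℝ) ≤ T := one_le_two.trans hT2
  have hrT : r ≤ T * Real.cos (polarAngle n T) := by
    have h3 : Real.cos (polarAngle n 2) ≤ Real.cos (polarAngle n T) :=
      Real.cos_le_cos_of_nonneg_of_le_pi (polarAngle_pos hn hT1).le (by linarith [Real.pi_pos])
        (h.strictAntiOn_polarAngle.antitoneOn (Set.mem_Ioi.2 (h.lt_one.trans one_lt_two))
          (Set.mem_Ioi.2 (h.lt_one.trans_le hT1)) hT2)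
    have h4 : r ≤ T * Real.cos (polarAngle n 2) := (div_le_iff₀ hk).1 (le_max_right _ _)
    exact h4.trans (mul_le_mul_of_nonneg_left h3 (by linarith))
  have hcont : ContinuousOn (fun ρ => ρ * Real.cos (polarAngle n ρ)) (Set.Icc 1 T) :=
    fun ρ hρ => (h.hasDerivAt_abscissa (h.lt_one.trans_le hρ.1)).continuousAt.continuousWithinAt
  obtain ⟨ρ, hρ, e⟩ := intermediate_value_Icc hT1 hcont
    (show r ∈ Set.Icc _ _ from ⟨by simpa [polarAngle_one] using hr, hrT⟩)
  exact ⟨ρ, hρ.1, e⟩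

/-! ### The solution in dimension greater than two -/

/-- The curve `ρ ↦ (ρ cos φ, ρ sin φ)` written as a graph `v = V ∘ P`, where `P` inverts the
abscissa. The slope of `v` is `tan α`. -/
theorem exists_radial_solution {n : ℕ} (hn : 2 < n) :
    ∃ v : ℝ → ℝ, (∀ r, 0 ≤ r → ContDiffAt ℝ ∞ v r) ∧ v 0 = 1 ∧ HasDerivAt v 1 0 ∧
      ∀ r, 0 < r → RadialODE n (1 - (n : ℝ)) v r := by
  obtain ⟨δ, h, hcos⟩ := exists_isRegularBeyond_graph hn
  set R : ℝ → ℝ := fun ρ => ρ * Real.cos (polarAngle n ρ) with hR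
  set V : ℝ → ℝ := fun ρ => ρ * Real.sin (polarAngle n ρ) with hV
  set P : ℝ → ℝ := Function.invFunOn R (Set.Ioi δ) with hP
  have hsqrt : ∀ ρ, δ < ρ → 0 < Real.sqrt (1 - sinAngle n ρ ^ 2) :=
    fun ρ hρ => Real.sqrt_pos.2 (h.one_sub_sq_pos hρ)
  have hRsmooth : ContDiffOn ℝ ∞ R (Set.Ioi δ) := contDiffOn_id.mul h.contDiffOn_polarAngle.cos
  have hVsmooth : ContDiffOn ℝ ∞ V (Set.Ioi δ) := contDiffOn_id.mul h.contDiffOn_polarAngle.sin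
  have hinj : Set.InjOn R (Set.Ioi δ) := by
    refine (strictMonoOn_of_deriv_pos (convex_Ioi δ) hRsmooth.continuousOn ?_).injOn
    rw [interior_Ioi]
    intro ρ hρ
    rw [(h.hasDerivAt_abscissa hρ).deriv]
    exact div_pos (hcos ρ hρ) (hsqrt ρ hρ)
  have hinv := fun ρ (hρ : δ < ρ) => invFunOn_of_hasDerivAt isOpen_Ioi hinj hRsmooth hρ
    (h.hasDerivAt_abscissa hρ) (div_pos (hcos ρ hρ) (hsqrt ρ hρ)).ne'
  have hPR : ∀ ρ, δ < ρ → P (R ρ) = ρ := fun ρ hρ => hinj.leftInvOn_invFunOn hρ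
  have hv : ∀ ρ, δ < ρ → HasDerivAt (V ∘ P) (Real.tan (tangentAngle n ρ)) (R ρ) := by
    intro ρ hρ
    have h1 := h.hasDerivAt_ordinate hρ
    rw [← hPR ρ hρ] at h1
    refine (h1.comp (R ρ) (hinv ρ hρ).2.1).congr_deriv ?_
    have h2 := hsqrt ρ hρ
    have h3 := hcos ρ hρ
    rw [hPR ρ hρ, Real.tan_eq_sin_div_cos]
    field_simp
  have hdv : ∀ ρ, δ < ρ → deriv (V ∘ P) =ᶠ[nhds (R ρ)] fun r => Real.tan (tangentAngle n (P r)) := by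
    intro ρ hρ
    filter_upwards [(hinv ρ hρ).2.2] with r hr
    have := (hv _ hr.1).deriv
    rwa [hr.2] at this
  have hv0 := fun ρ (hρ : δ < ρ) => (hv ρ hρ).deriv
  have hR1 : R 1 = 0 := by simp [hR, polarAngle_one]
  refine ⟨V ∘ P, fun r hr => ?_, ?_, ?_, fun r hr => ?_⟩
  · obtain ⟨ρ, hρ, rfl⟩ := exists_abscissa_eq hn hr
    have hρ' : δ < ρ := h.lt_one.trans_le hρ
    refine ContDiffAt.comp (R ρ) ?_ (hinv ρ hρ').1
    rw [hPR ρ hρ']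
    exact hVsmooth.contDiffAt (isOpen_Ioi.mem_nhds hρ')
  · rw [Function.comp_apply, ← hR1, hPR 1 h.lt_one]
    simp [hV, polarAngle_one]
  · have := hv 1 h.lt_one
    rwa [hR1, tangentAngle_one, Real.tan_pi_div_four] at this
  · obtain ⟨ρ, hρ1, rfl⟩ := exists_abscissa_eq hn hr.le
    have hρ : δ < ρ := h.lt_one.trans_le hρ1
    change RadialODE n (1 - (n : ℝ)) (V ∘ P) (R ρ)
    have h0 := h.pos hρ
    have hc := hcos ρ hρ
    have hs := hsqrt ρ hρ
    have hdd : HasDerivAt (deriv (V ∘ P))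
        (((-(((n : ℝ) - 1) * sinAngle n ρ / ρ) - ((n : ℝ) - 1) / ρ ^ (n - 1)))
          / Real.cos (tangentAngle n ρ) ^ 3) (R ρ) := by
      have h1 := h.hasDerivAt_tangentAngle (by omega) hρ
      rw [← hPR ρ hρ] at h1
      have h2 := h1.comp (R ρ) (hinv ρ hρ).2.1
      have h3 := (Real.hasDerivAt_tan (x := (tangentAngle n ∘ P) (R ρ))
        (by rw [Function.comp_apply, hPR ρ hρ]; exact hc.ne')).comp (R ρ) h2
      refine (h3.congr_of_eventuallyEq (hdv ρ hρ)).congr_deriv ?_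
      rw [Function.comp_apply, hPR ρ hρ]
      field_simp
    have htan : 1 + Real.tan (tangentAngle n ρ) ^ 2 = 1 / Real.cos (tangentAngle n ρ) ^ 2 := by
      rw [← Real.inv_one_add_tan_sq hc.ne', one_div, inv_inv]
    have hsq : R ρ ^ 2 + (V ∘ P) (R ρ) ^ 2 = ρ ^ 2 := by
      rw [Function.comp_apply, hPR ρ hρ]
      simp only [hR, hV]
      linear_combination ρ ^ 2 * Real.sin_sq_add_cos_sq (polarAngle n ρ)
    -- `ρ sin ψ` is the cross product of the position with the unit tangent
    have hcross : Real.tan (tangentAngle n ρ) * R ρ - (V ∘ P) (R ρ)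
        = ρ * sinAngle n ρ / Real.cos (tangentAngle n ρ) := by
      rw [Function.comp_apply, hPR ρ hρ, Real.tan_eq_sin_div_cos, eq_div_iff hc.ne', sub_mul,
        mul_right_comm, div_mul_cancel₀ _ hc.ne']
      simp only [hR, hV]
      rw [h.cos_tangentAngle hρ, h.sin_tangentAngle hρ]
      linear_combination ρ * sinAngle n ρ * Real.sin_sq_add_cos_sq (polarAngle n ρ)
    rw [RadialODE, hdd.deriv, hv0 ρ hρ, htan, hsq, hcross, ← pow_mul, mul_comm 2, pow_mul,
      Real.sqrt_sq (by positivity), Real.sqrt_div zero_le_one, Real.sqrt_one,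
      Real.sqrt_sq hc.le]
    field_simp
    ring

theorem exists_not_special {n : ℕ} (hn : 2 < n) :
    ∃ v f : ℝ → ℝ,
      ContDiffOn ℝ 2 v (Set.Ici 0) ∧ v 0 = 1 ∧ HasDerivWithinAt v 1 (Set.Ici 0) 0 ∧
      (∀ r : ℝ, 0 < r → RadialODE n (1 - (n : ℝ)) v r) ∧
      (∀ r : ℝ, 0 < r → HasDerivAt f (v r) r) ∧
      ∀ Ω : Set (EuclideanSpace ℝ (Fin n)),
        IsOpen Ω → IsConnected Ω → ¬ Bornology.IsBounded Ω → Ω ⊆ {0}ᶜ →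
          IsHamiltonianStationaryOn Ω (fun x => f ‖x‖) ∧
          ¬ IsSpecialLagrangianOn Ω (fun x => f ‖x‖) := by
  obtain ⟨v, hv, hv0, hv1, hode⟩ := exists_radial_solution hn
  have hvI : ContDiffOn ℝ ∞ v (Set.Ioi 0) := fun r hr =>
    (hv r (le_of_lt hr)).contDiffWithinAt
  have hf : ∀ r ∈ Set.Ioi (0 : ℝ), HasDerivAt (fun r => ∫ s in (1 : ℝ)..r, v s) (v r) r :=
    fun r hr => hasDerivAt_integral_of_contDiffOn isOpen_Ioi Set.ordConnected_Ioi hvI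
      (Set.mem_Ioi.2 one_pos) hr
  refine ⟨v, fun r => ∫ s in (1 : ℝ)..r, v s, fun r hr =>
    (contDiffAt_infty.1 (hv r hr) 2).contDiffWithinAt, hv0, hv1.hasDerivWithinAt, hode,
    hf, fun Ω hΩ hconn _ hΩ0 => ?_⟩
  have hrad : IsRadialOn Ω (fun x => ∫ s in (1 : ℝ)..‖x‖, v s) (Set.Ioi 0)
      (fun r => ∫ s in (1 : ℝ)..r, v s) :=
    ⟨hΩ, isOpen_Ioi, subset_rfl, fun x hx => norm_pos_iff.2 (hΩ0 hx), fun _ _ => rfl,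
      contDiffOn_of_hasDerivAt isOpen_Ioi hf hvI⟩
  have hv' := hrad.contDiffOn_deriv
  have hflux : ∀ r ∈ Set.Ioi (0 : ℝ),
      radialFlux n (deriv fun r => ∫ s in (1 : ℝ)..r, v s) r = 1 - (n : ℝ) := by
    intro r hr
    have he : (deriv fun r => ∫ s in (1 : ℝ)..r, v s) =ᶠ[nhds r] v :=
      Filter.eventuallyEq_of_mem (isOpen_Ioi.mem_nhds hr) fun s hs => (hf s hs).deriv
    rw [← radialODE_iff n _ hr (differentiableAt_of_contDiffOn isOpen_Ioi hv' hr)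
      (differentiableAt_of_contDiffOn isOpen_Ioi (contDiffOn_deriv isOpen_Ioi hv') hr),
      RadialODE, he.deriv.deriv_eq, he.deriv_eq, he.eq_of_nhds]
    exact hode r hr
  refine ⟨⟨hrad.contDiffOn_comp_norm, fun x hx => ?_⟩, fun hsp => ?_⟩
  · rw [hrad.laplaceBeltrami_eq_zero_iff hx]
    have he : radialFlux n (deriv fun r => ∫ s in (1 : ℝ)..r, v s)
        =ᶠ[nhds ‖x‖] fun _ => 1 - (n : ℝ) :=
      Filter.eventuallyEq_of_mem (isOpen_Ioi.mem_nhds (hrad.norm_pos hx)) hflux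
    rw [he.deriv_eq, deriv_const]
  · obtain ⟨x, hx⟩ := hconn.nonempty
    have h1 := (hrad.grad_phase_eq_zero_iff hx).1 (hsp.2 x hx)
    have h2 := hflux ‖x‖ (hrad.norm_pos hx)
    rw [radialFlux, h1, mul_zero, zero_div] at h2
    have h3 : (2 : ℝ) < n := by exact_mod_cast hn
    linarith

end HamiltonianStationary

end

theorem theorem1 :
    -- dimension 2: radial solutions on exterior domains are special Lagrangian
    (∀ (a : ℝ), 0 ≤ a → ∀ (u : EuclideanSpace ℝ (Fin 2) → ℝ) (f : ℝ → ℝ),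
      (∀ x : EuclideanSpace ℝ (Fin 2), a < ‖x‖ → u x = f ‖x‖) →
      HamiltonianStationary.IsHamiltonianStationaryOn {x | a < ‖x‖} u →
        HamiltonianStationary.IsSpecialLagrangianOn {x | a < ‖x‖} u ∧
        (∃ c : ℝ, ∀ x : EuclideanSpace ℝ (Fin 2), a < ‖x‖ →
          HamiltonianStationary.phase u x = c) ∧
        (∀ C : ℝ, (∀ r : ℝ, a < r → HamiltonianStationary.RadialODE 2 C (deriv f) r) ↔ C = 0)) ∧
    -- dimension n > 2: a radial solution that is not special Lagrangian on any unbounded domain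
    (∀ n : ℕ, 2 < n → ∃ v f : ℝ → ℝ,
      ContDiffOn ℝ 2 v (Set.Ici 0) ∧ v 0 = 1 ∧ HasDerivWithinAt v 1 (Set.Ici 0) 0 ∧
      (∀ r : ℝ, 0 < r → HamiltonianStationary.RadialODE n (1 - (n : ℝ)) v r) ∧
      (∀ r : ℝ, 0 < r → HasDerivAt f (v r) r) ∧
      ∀ Ω : Set (EuclideanSpace ℝ (Fin n)),
        IsOpen Ω → IsConnected Ω → ¬ Bornology.IsBounded Ω → Ω ⊆ {0}ᶜ →
          HamiltonianStationary.IsHamiltonianStationaryOn Ω (fun x => f ‖x‖) ∧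
          ¬ HamiltonianStationary.IsSpecialLagrangianOn Ω (fun x => f ‖x‖)) := by
  exact ⟨fun _ ha _ _ hu hs => HamiltonianStationary.special_of_exterior ha hu hs,
    fun _ hn => HamiltonianStationary.exists_not_special hn⟩
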